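/- Let $n\in\mathbb N$, let $H_0\in\mathbb C^{n\times n}$ be Hermitian and let $T\in(0,\infty]$ (with $e^{-H_0/T}=\mathbb 1$ for $T=\infty$). Let $\mathcal L(\mathbb C^{n\times n})$ be the space of all linear operators on $\mathbb C^{n\times n}$. Let $\mathsf{Gibbs}(H_0,T)$ be the set of all completely positive, trace-preserving $\Phi\in\mathcal L(\mathbb C^{n\times n})$ with $\Phi(e^{-H_0/T})=e^{-H_0/T}$, and let $\mathsf{EnTO}(H_0,T):=\{\Phi\in\mathsf{Gibbs}(H_0,T):[\Phi,\operatorname{ad}_{H_0}]=0\}$, where $\operatorname{ad}_H(\rho):=H\rho-\rho H$. For $S\subseteq\mathcal L(\mathbb C^{n\times n})$ let $\mathsf L(S):=\{L\in\mathcal L(\mathbb C^{n\times n}): e^{tL}\in S\text{ for all }t\ge 0\}$ be its Lie wedge. Call $L\in\mathcal L(\mathbb C^{n\times n})$ of GKSL-form if there are a Hermitian $H\in\mathbb C^{n\times n}$ and finitely many $V_k\in\mathbb C^{n\times n}$ such that, for all $\rho\in\mathbb C^{n\times n}$, $$L(\rho)=-i[H,\rho]-\sum_k\Big(\tfrac12\big(V_k^\dagger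 V_k\rho+\rho V_k^\dagger V_k\big)-V_k\rho V_k^\dagger\Big).$$ Then $$\mathsf L(\mathsf{Gibbs}(H_0,T))=\{L\in\mathcal L(\mathbb C^{n\times n}): L\text{ is of GKSL-form and }L(e^{-H_0/T})=0\},$$ $$\mathsf L(\mathsf{EnTO}(H_0,T))=\{L\in\mathcal L(\mathbb C^{n\times n}): L\in\mathsf L(\mathsf{Gibbs}(H_0,T))\text{ and }[L,\operatorname{ad}_{H_0}]=0\}.$$ -/

import Mathlib

open scoped Matrix Matrix.Norms.L2Operator MatrixOrder CStarAlgebra ENNReal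

noncomputable section

namespace QuantumMaps

/-- The complex `n × n` matrices. They carry the operator norm and the order in which the
nonnegative elements are the positive semidefinite matrices. -/
abbrev Mat (n : ℕ) : Type := Matrix (Fin n) (Fin n) ℂ

/-- The algebra of linear operators on the complex `n × n` matrices, with composition as product.
All of them are continuous, since the space is finite-dimensional. -/
abbrev SuperOp (n : ℕ) : Type := Mat n →L[ℂ] Mat n

/-- The operator `ad_H`, which maps `ρ` to `[H, ρ] = H * ρ - ρ * H`. -/
def adOp {n : ℕ} (H : Mat n) : SuperOp n :=
  LinearMap.toContinuousLinearMap (LinearMap.mulLeft ℂ H - LinearMap.mulRight ℂ H)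

theorem adOp_apply {n : ℕ} (H ρ : Mat n) : adOp H ρ = H * ρ - ρ * H := rfl

/-- The completely positive and trace-preserving maps. -/
def CPTP (n : ℕ) : Set (SuperOp n) :=
  {Φ | (∃ Ψ : Mat n →CP Mat n, ∀ ρ : Mat n, Ψ ρ = Φ ρ) ∧
    ∀ ρ : Mat n, (Φ ρ).trace = ρ.trace}

/-- The Lie wedge of a set `S` of linear operators: all `A` such that `exp (t A)` lies in `S` for
every `t ≥ 0`. -/
def lieWedge {Z : Type*} [NormedAddCommGroup Z] [NormedSpace ℂ Z] (S : Set (Z →L[ℂ] Z)) :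
    Set (Z →L[ℂ] Z) :=
  {A | ∀ t : ℝ, 0 ≤ t → NormedSpace.exp ((t : ℂ) • A) ∈ S}

/-- The matrix `exp (-H₀ / T)`, where `T` may be infinite; `1 / T` is zero in that case. -/
def gibbsMatrix {n : ℕ} (H₀ : Mat n) (T : ℝ≥0∞) : Mat n :=
  NormedSpace.exp (-(((T⁻¹).toReal : ℂ) • H₀))

/-- The completely positive trace-preserving maps that leave `exp (-H₀ / T)` invariant. -/
def Gibbs {n : ℕ} (H₀ : Mat n) (T : ℝ≥0∞) : Set (SuperOp n) :=
  {Φ | Φ ∈ CPTP n ∧ Φ (gibbsMatrix H₀ T) = gibbsMatrix H₀ T}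

/-- The enhanced thermal operations: the elements of `Gibbs H₀ T` that commute with `ad_{H₀}`. -/
def EnTO {n : ℕ} (H₀ : Mat n) (T : ℝ≥0∞) : Set (SuperOp n) :=
  {Φ | Φ ∈ Gibbs H₀ T ∧ ⁅Φ, adOp H₀⁆ = 0}

/-- The dissipator
`Γ(ρ) = ∑ₖ (½ (Vₖ† Vₖ ρ + ρ Vₖ† Vₖ) - Vₖ ρ Vₖ†)` of a finite family of matrices. -/
def dissipator {n m : ℕ} (V : Fin m → Mat n) (ρ : Mat n) : Mat n :=
  ∑ k, ((1 / 2 : ℂ) • ((V k)ᴴ * V k * ρ + ρ * ((V k)ᴴ * V k)) - V k * ρ * (V k)ᴴ)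

/-- `L` is of GKSL form: `L = -(i ad_H + Γ)` for a Hermitian matrix `H` and a dissipator `Γ` of
finitely many arbitrary matrices `Vₖ`. -/
def IsGKSL {n : ℕ} (L : SuperOp n) : Prop :=
  ∃ H : Mat n, H.IsHermitian ∧ ∃ (m : ℕ) (V : Fin m → Mat n),
    ∀ ρ : Mat n, L ρ = -(Complex.I • adOp H ρ + dissipator V ρ)

end QuantumMaps

end

open Filter Topology

/-! ### Exponentials in Banach algebras. -/

section Exponential

variable {𝔸 : Type*} [NormedRing 𝔸] [NormedAlgebra ℂ 𝔸] [CompleteSpace 𝔸]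

/-! Both sets are intersections of `CPTP` with linear conditions, and the Lie wedge of an
intersection is the intersection of the Lie wedges. Fixing a matrix or commuting with one operator
passes to the generator by differentiating at `0` and back by the power series. What remains is the
GKSL theorem `mem_lieWedge_CPTP_iff`. GKSL form implies complete positivity since `1 + s L` is
completely positive up to a term of order `s²`, and the completely positive maps form a closed
multiplicative cone (`exp_smul_mem_of_cone`). Conversely, differentiating Choi matrices shows that
`choi L` is positive off the maximally entangled vector (`compressed_choi_posSemidef`). Its positive
part gives the `Vₖ`, the rest gives `K`, and trace preservation fixes the Hermitian part of `K`. -/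

theorem exp_map_eq_map_one {E : Type*} [NormedAddCommGroup E] [NormedSpace ℂ E] (F : 𝔸 →L[ℂ] E)
    {A : 𝔸} (h : ∀ k : ℕ, F (A ^ (k + 1)) = 0) : F (NormedSpace.exp A) = F 1 := by
  have h1 := (NormedSpace.exp_series_hasSum_exp' (𝕂 := ℂ) A).mapL F
  have h2 := hasSum_single (f := fun k : ℕ => F (((k.factorial : ℂ)⁻¹) • A ^ k)) 0 (by
    rintro (_ | k) hk
    · exact absurd rfl hk
    · rw [map_smul, h, smul_zero])
  have h3 := h1.unique h2
  simpa using h3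

/-- The difference quotients of `t ↦ exp (t A)` at `0` converge to `A`. -/
theorem tendsto_inv_smul_exp_sub_one (A : 𝔸) :
    Tendsto (fun t : ℝ => ((t : ℂ)⁻¹) • (NormedSpace.exp ((t : ℂ) • A) - 1)) (𝓝[>] 0) (𝓝 A) := by
  have h := (hasDerivAt_exp_smul_const (𝕂 := ℂ) A 0).tendsto_slope_zero
  simp only [zero_smul, NormedSpace.exp_zero, zero_add, one_mul] at h
  refine h.comp (tendsto_nhdsWithin_iff.mpr ⟨?_, ?_⟩)
  · have : Tendsto (fun t : ℝ => (t : ℂ)) (𝓝 0) (𝓝 ((0 : ℝ) : ℂ)) :=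
      Complex.continuous_ofReal.tendsto 0
    exact (by simpa using this.mono_left nhdsWithin_le_nhds)
  · filter_upwards [self_mem_nhdsWithin] with t ht
    simpa using (ne_of_gt ht : t ≠ 0)

theorem map_eq_zero_of_exp_map_eq {E : Type*} [NormedAddCommGroup E] [NormedSpace ℂ E]
    (F : 𝔸 →L[ℂ] E) {A : 𝔸} (h : ∀ t : ℝ, 0 ≤ t → F (NormedSpace.exp ((t : ℂ) • A)) = F 1) :
    F A = 0 := by
  have h1 := (F.continuous.tendsto A).comp (tendsto_inv_smul_exp_sub_one A)
  refine tendsto_nhds_unique h1 (tendsto_const_nhds.congr' ?_)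
  filter_upwards [self_mem_nhdsWithin] with t ht
  rw [Function.comp_apply, map_smul, map_sub, h t (le_of_lt ht), sub_self, smul_zero]

/-- A closed convex cone that is a multiplicative submonoid is stable under the exponential. -/
theorem exp_mem_of_cone {S : Set 𝔸} (hc : IsClosed S) (h1 : 1 ∈ S)
    (hadd : ∀ a ∈ S, ∀ b ∈ S, a + b ∈ S) (hmul : ∀ a ∈ S, ∀ b ∈ S, a * b ∈ S)
    (hsmul : ∀ r : ℝ, 0 ≤ r → ∀ a ∈ S, (r : ℂ) • a ∈ S) {A : 𝔸} (hA : A ∈ S) :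
    NormedSpace.exp A ∈ S := by
  have h0 : (0 : 𝔸) ∈ S := by simpa using hsmul 0 le_rfl 1 h1
  have hpow (k : ℕ) : A ^ k ∈ S := by
    induction k with
    | zero => simpa using h1
    | succ k ih => exact pow_succ A k ▸ hmul _ ih _ hA
  refine hc.mem_of_tendsto (NormedSpace.exp_series_hasSum_exp' (𝕂 := ℂ) A)
    (Eventually.of_forall fun s => ?_)
  refine Finset.sum_induction _ (· ∈ S) (fun a b ha hb => hadd a ha b hb) h0 fun k _ => ?_
  simpa using hsmul ((k.factorial : ℝ)⁻¹) (by positivity) _ (hpow k)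

/-- If `1 + s L + s² M` lies in a closed multiplicative cone for all `s > 0`, then so does
`exp (t L)` for `t ≥ 0`. -/
theorem exp_smul_mem_of_cone {S : Set 𝔸} (hc : IsClosed S) (h1 : 1 ∈ S)
    (hadd : ∀ a ∈ S, ∀ b ∈ S, a + b ∈ S) (hmul : ∀ a ∈ S, ∀ b ∈ S, a * b ∈ S)
    (hsmul : ∀ r : ℝ, 0 ≤ r → ∀ a ∈ S, (r : ℂ) • a ∈ S) {L M : 𝔸}
    (hLM : ∀ s : ℝ, 0 < s → 1 + (s : ℂ) • L + (s : ℂ) ^ 2 • M ∈ S) {t : ℝ} (ht : 0 ≤ t) :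
    NormedSpace.exp ((t : ℂ) • L) ∈ S := by
  let _ : NormedAlgebra ℚ 𝔸 := NormedAlgebra.restrictScalars ℚ ℂ 𝔸
  have hlim : Tendsto (fun s : ℝ => NormedSpace.exp ((t : ℂ) • (L + (s : ℂ) • M))) (𝓝[>] 0)
      (𝓝 (NormedSpace.exp ((t : ℂ) • L))) := by
    have hcont : Continuous fun s : ℝ => NormedSpace.exp ((t : ℂ) • (L + (s : ℂ) • M)) :=
      (NormedSpace.exp_continuous (𝔸 := 𝔸)).comp (by fun_prop)
    simpa using (hcont.tendsto 0).mono_left nhdsWithin_le_nhds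
  refine hc.mem_of_tendsto hlim ?_
  filter_upwards [self_mem_nhdsWithin] with s (hs : 0 < s)
  have hs' : (s : ℂ) ≠ 0 := by exact_mod_cast hs.ne'
  set B : 𝔸 := 1 + (s : ℂ) • L + (s : ℂ) ^ 2 • M with hB
  -- The negative multiple of `1` is central and exponentiates to a positive scalar, so only `exp
  -- ((t / s) B)` with `B` in the cone matters.
  have hsplit : (t : ℂ) • (L + (s : ℂ) • M) =
      algebraMap ℂ 𝔸 ((-(t / s) : ℝ) : ℂ) + ((t / s : ℝ) : ℂ) • B := by
    rw [Algebra.algebraMap_eq_smul_one, hB]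
    simp only [smul_add, smul_smul]
    have e1 : ((t / s : ℝ) : ℂ) * (s : ℂ) = t := by push_cast; field_simp
    have e2 : ((t / s : ℝ) : ℂ) * (s : ℂ) ^ 2 = t * s := by push_cast; field_simp
    rw [e1, e2]
    push_cast
    rw [neg_smul]
    abel
  rw [hsplit, NormedSpace.exp_add_of_commute (Algebra.commutes _ _),
    ← NormedSpace.algebraMap_exp_comm, ← Complex.exp_eq_exp_ℂ, ← Complex.ofReal_exp,
    ← Algebra.smul_def]
  exact hsmul _ (Real.exp_nonneg _) _ (exp_mem_of_cone hc h1 hadd hmul hsmul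
    (hsmul _ (by positivity) _ (hLM s hs)))

theorem exp_lie_eq_zero_iff {L A : 𝔸} :
    (∀ t : ℝ, 0 ≤ t → ⁅NormedSpace.exp ((t : ℂ) • L), A⁆ = 0) ↔ ⁅L, A⁆ = 0 := by
  let F : 𝔸 →L[ℂ] 𝔸 := (ContinuousLinearMap.mul ℂ 𝔸).flip A - ContinuousLinearMap.mul ℂ 𝔸 A
  have hF (Φ : 𝔸) : F Φ = ⁅Φ, A⁆ := rfl
  refine ⟨fun h => ?_, fun h t _ => ?_⟩
  · rw [← hF]
    refine map_eq_zero_of_exp_map_eq F fun t ht => ?_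
    rw [hF, hF, h t ht, Ring.lie_def, one_mul, mul_one, sub_self]
  · have hc : Commute L A := commute_iff_lie_eq.mpr h
    exact commute_iff_lie_eq.mp ((hc.smul_left (t : ℂ)).exp_left)

end Exponential

/-! ### The cone of completely positive maps. -/

noncomputable section

namespace QuantumMaps

variable {n : ℕ}

/-- The cone of completely positive maps. -/
def cpCone (n : ℕ) : Set (SuperOp n) :=
  {Φ | ∀ (k : ℕ) (M : CStarMatrix (Fin k) (Fin k) (Mat n)), 0 ≤ M → 0 ≤ M.map Φ}

theorem mem_CPTP_iff {Φ : SuperOp n} :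
    Φ ∈ CPTP n ↔ Φ ∈ cpCone n ∧ ∀ ρ : Mat n, (Φ ρ).trace = ρ.trace := by
  refine and_congr_left fun _ => ⟨?_, fun h => ?_⟩
  · rintro ⟨Ψ, hΨ⟩ k M hM
    rw [show (Φ : Mat n → Mat n) = Ψ from funext fun ρ => (hΨ ρ).symm]
    exact CompletelyPositiveMapClass.map_cstarMatrix_nonneg' Ψ k M hM
  · exact ⟨⟨(Φ : Mat n →ₗ[ℂ] Mat n), fun k M hM => h k M hM⟩, fun _ => rfl⟩

theorem isClosed_cpCone : IsClosed (cpCone n) := by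
  simp only [cpCone, Set.ofPred_forall]
  refine isClosed_iInter fun k => isClosed_iInter fun M => isClosed_iInter fun _ => ?_
  refine isClosed_le continuous_const ?_
  -- The topology on `CStarMatrix` is entrywise.
  refine continuous_pi fun i => continuous_pi fun j => ?_
  exact (ContinuousLinearMap.apply ℂ (Mat n) (M i j)).continuous

theorem one_mem_cpCone : 1 ∈ cpCone n := fun _ _ hM => hM

theorem zero_mem_cpCone : (0 : SuperOp n) ∈ cpCone n :=
  fun k _ _ => le_refl (0 : CStarMatrix (Fin k) (Fin k) (Mat n))

theorem add_mem_cpCone {Φ Ψ : SuperOp n} (hΦ : Φ ∈ cpCone n) (hΨ : Ψ ∈ cpCone n) :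
    Φ + Ψ ∈ cpCone n := fun k M hM => add_nonneg (hΦ k M hM) (hΨ k M hM)

theorem mul_mem_cpCone {Φ Ψ : SuperOp n} (hΦ : Φ ∈ cpCone n) (hΨ : Ψ ∈ cpCone n) :
    Φ * Ψ ∈ cpCone n := fun k M hM => hΦ k _ (hΨ k M hM)

theorem smul_mem_cpCone {r : ℝ} (hr : 0 ≤ r) {Φ : SuperOp n} (hΦ : Φ ∈ cpCone n) :
    (r : ℂ) • Φ ∈ cpCone n := by
  intro k M hM
  have h := smul_nonneg hr (hΦ k M hM)
  convert h using 1
  ext i j : 2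
  simp

/-- The map `ρ ↦ V ρ V†`. -/
def conjOp (V : Mat n) : SuperOp n :=
  LinearMap.toContinuousLinearMap (LinearMap.mulLeft ℂ V ∘ₗ LinearMap.mulRight ℂ Vᴴ)

@[simp]
theorem conjOp_apply (V ρ : Mat n) : conjOp V ρ = V * ρ * Vᴴ := by
  simp [conjOp, mul_assoc]

theorem conjOp_mem_cpCone (V : Mat n) : conjOp V ∈ cpCone n := by
  intro k M hM
  let D : CStarMatrix (Fin k) (Fin k) (Mat n) := CStarMatrix.ofMatrix (Matrix.diagonal fun _ => V)
  have h := star_right_conjugate_nonneg hM D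
  convert h using 1
  refine CStarMatrix.ext fun i j => ?_
  simp [CStarMatrix.mul_apply, CStarMatrix.star_apply, D, Matrix.diagonal_apply,
    apply_ite Matrix.conjTranspose, Matrix.star_eq_conjTranspose]

theorem sum_mem_cpCone {ι : Type*} (s : Finset ι) {Φ : ι → SuperOp n}
    (h : ∀ i ∈ s, Φ i ∈ cpCone n) : ∑ i ∈ s, Φ i ∈ cpCone n :=
  Finset.sum_induction _ (· ∈ cpCone n) (fun _ _ => add_mem_cpCone)
    zero_mem_cpCone h

/-! ### GKSL generators yield completely positive, trace-preserving semigroups. -/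

/-- The Kraus operator `K` with `L ρ = K ρ + ρ K† + ∑ₖ Vₖ ρ Vₖ†` for `L` of GKSL form. -/
theorem IsGKSL.exists_form {L : SuperOp n} (hL : IsGKSL L) :
    ∃ (K : Mat n) (m : ℕ) (V : Fin m → Mat n), K + Kᴴ + ∑ k, (V k)ᴴ * V k = 0 ∧
      ∀ ρ, L ρ = K * ρ + ρ * Kᴴ + ∑ k, V k * ρ * (V k)ᴴ := by
  obtain ⟨H, hH, m, V, h⟩ := hL
  have hS : (∑ k, (V k)ᴴ * V k)ᴴ = ∑ k, (V k)ᴴ * V k := by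
    simp [Matrix.conjTranspose_sum]
  have hK : (-(Complex.I • H) - (1 / 2 : ℂ) • ∑ k, (V k)ᴴ * V k)ᴴ =
      Complex.I • H - (1 / 2 : ℂ) • ∑ k, (V k)ᴴ * V k := by
    rw [Matrix.conjTranspose_sub, Matrix.conjTranspose_neg, Matrix.conjTranspose_smul,
      Matrix.conjTranspose_smul, hS, hH.eq]
    simp
  refine ⟨-(Complex.I • H) - (1 / 2 : ℂ) • ∑ k, (V k)ᴴ * V k, m, V, ?_, fun ρ => ?_⟩
  · rw [hK]
    module
  · rw [h, hK, adOp_apply, dissipator, Finset.sum_sub_distrib, ← Finset.smul_sum,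
      Finset.sum_add_distrib, ← Finset.sum_mul, ← Finset.mul_sum]
    simp only [sub_mul, mul_sub, neg_mul, smul_mul_assoc, mul_smul_comm]
    module

/-- The hypothesis `hK` makes the Hermitian part of `K` equal to `-½ ∑ Vₖ† Vₖ`; the skew part is `-i
H`, whence `H = (i/2)(K - K†)`. -/
theorem isGKSL_of_form {L : SuperOp n} {K : Mat n} {ι : Type*} [Fintype ι] {V : ι → Mat n}
    (hK : K + Kᴴ + ∑ k, (V k)ᴴ * V k = 0)
    (hL : ∀ ρ, L ρ = K * ρ + ρ * Kᴴ + ∑ k, V k * ρ * (V k)ᴴ) : IsGKSL L := by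
  have hsum {f : ι → Mat n} : ∑ k, f ((Fintype.equivFin ι).symm k) = ∑ k, f k :=
    Equiv.sum_comp (Fintype.equivFin ι).symm f
  have hS : ∑ k, (V k)ᴴ * V k = -(K + Kᴴ) := by
    rw [eq_neg_iff_add_eq_zero, add_comm, hK]
  refine ⟨(Complex.I / 2) • (K - Kᴴ), ?_, Fintype.card ι,
    fun k => V ((Fintype.equivFin ι).symm k), fun ρ => ?_⟩
  · rw [Matrix.IsHermitian, Matrix.conjTranspose_smul, Matrix.conjTranspose_sub,
      Matrix.conjTranspose_conjTranspose]
    have : star (Complex.I / 2) = -(Complex.I / 2) := by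
      simp [neg_div]
    rw [this]
    module
  · rw [hL, adOp_apply, dissipator, hsum (f := fun k => (1 / 2 : ℂ) • ((V k)ᴴ * V k * ρ +
      ρ * ((V k)ᴴ * V k)) - V k * ρ * (V k)ᴴ), Finset.sum_sub_distrib, ← Finset.smul_sum,
      Finset.sum_add_distrib, ← Finset.sum_mul, ← Finset.mul_sum, hS]
    have hI : Complex.I * (Complex.I / 2) = -(1 / 2) := by
      rw [mul_div_assoc', Complex.I_mul_I, neg_div]
    simp only [smul_mul_assoc, mul_smul_comm, ← smul_sub, smul_smul, hI]
    simp only [sub_mul, mul_sub, neg_mul, mul_neg, add_mul, mul_add]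
    module

theorem kraus_mem_cpCone {K : Mat n} {m : ℕ} {V : Fin m → Mat n} {s : ℝ} (hs : 0 ≤ s) :
    conjOp (1 + (s : ℂ) • K) + (s : ℂ) • ∑ k, conjOp (V k) ∈ cpCone n :=
  add_mem_cpCone (conjOp_mem_cpCone _)
    (smul_mem_cpCone hs (sum_mem_cpCone Finset.univ fun k _ => conjOp_mem_cpCone (V k)))

/-- Expanding `(1 + s K) ρ (1 + s K)†` gives the first-order terms of `L` with the single excess `s²
K ρ K†`, which plays the role of `M` in `exp_smul_mem_of_cone`. -/
theorem kraus_eq {L : SuperOp n} {K : Mat n} {m : ℕ} {V : Fin m → Mat n}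
    (h : ∀ ρ, L ρ = K * ρ + ρ * Kᴴ + ∑ k, V k * ρ * (V k)ᴴ) (s : ℝ) :
    conjOp (1 + (s : ℂ) • K) + (s : ℂ) • ∑ k, conjOp (V k) =
      1 + (s : ℂ) • L + (s : ℂ) ^ 2 • conjOp K := by
  refine ContinuousLinearMap.ext fun ρ => ?_
  rw [add_apply, add_apply, add_apply,
    smul_apply, smul_apply,
    smul_apply, sum_apply, h]
  simp only [conjOp_apply, one_apply_eq_self, Matrix.conjTranspose_add,
    Matrix.conjTranspose_one, Matrix.conjTranspose_smul, add_mul, mul_add, one_mul, mul_one,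
    smul_mul_assoc, mul_smul_comm, Complex.star_def, Complex.conj_ofReal]
  module

theorem exp_mem_cpCone {L : SuperOp n} (hL : IsGKSL L) {t : ℝ} (ht : 0 ≤ t) :
    NormedSpace.exp ((t : ℂ) • L) ∈ cpCone n := by
  obtain ⟨K, m, V, -, h⟩ := hL.exists_form
  have hLM (s : ℝ) (hs : 0 < s) : 1 + (s : ℂ) • L + (s : ℂ) ^ 2 • conjOp K ∈ cpCone n :=
    kraus_eq h s ▸ kraus_mem_cpCone hs.le
  have hadd : ∀ Φ ∈ cpCone n, ∀ Ψ ∈ cpCone n, Φ + Ψ ∈ cpCone n :=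
    fun _ ha _ hb => add_mem_cpCone ha hb
  have hmul : ∀ Φ ∈ cpCone n, ∀ Ψ ∈ cpCone n, Φ * Ψ ∈ cpCone n :=
    fun _ ha _ hb => mul_mem_cpCone ha hb
  have hsmul : ∀ r : ℝ, 0 ≤ r → ∀ Φ ∈ cpCone n, (r : ℂ) • Φ ∈ cpCone n :=
    fun _ hr _ ha => smul_mem_cpCone hr ha
  have hc := isClosed_cpCone (n := n)
  have h1 := one_mem_cpCone (n := n)
  generalize cpCone n = S at *
  exact exp_smul_mem_of_cone (𝔸 := SuperOp n) hc h1 hadd hmul hsmul hLM ht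

theorem trace_sum_conj {ι : Type*} [Fintype ι] (V : ι → Mat n) (ρ : Mat n) :
    (∑ k, V k * ρ * (V k)ᴴ).trace = ((∑ k, (V k)ᴴ * V k) * ρ).trace := by
  rw [Matrix.trace_sum, Finset.sum_mul, Matrix.trace_sum]
  exact Finset.sum_congr rfl fun k _ => by rw [Matrix.trace_mul_comm, ← mul_assoc]

theorem IsGKSL.trace_eq_zero {L : SuperOp n} (hL : IsGKSL L) (ρ : Mat n) : (L ρ).trace = 0 := by
  obtain ⟨K, m, V, hK, h⟩ := hL.exists_form
  rw [h, Matrix.trace_add, trace_sum_conj, Matrix.trace_add, Matrix.trace_mul_comm ρ, ← Matrix.trace_add,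
    ← Matrix.trace_add, ← add_mul, ← add_mul, hK, zero_mul, Matrix.trace_zero]

/-- The functional `Φ ↦ tr (Φ ρ)`. -/
def traceAt (ρ : Mat n) : SuperOp n →L[ℂ] ℂ :=
  (LinearMap.toContinuousLinearMap (Matrix.traceLinearMap (Fin n) ℂ ℂ)).comp
    (ContinuousLinearMap.apply ℂ (Mat n) ρ)

theorem traceAt_apply (ρ : Mat n) (Φ : SuperOp n) : traceAt ρ Φ = (Φ ρ).trace := rfl

theorem exp_mem_CPTP {L : SuperOp n} (hL : IsGKSL L) {t : ℝ} (ht : 0 ≤ t) :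
    NormedSpace.exp ((t : ℂ) • L) ∈ CPTP n := by
  refine mem_CPTP_iff.mpr ⟨exp_mem_cpCone hL ht, fun ρ => ?_⟩
  refine exp_map_eq_map_one (𝔸 := SuperOp n) (traceAt ρ) fun k => ?_
  rw [traceAt_apply, pow_succ', mul_apply_eq_comp, smul_apply,
    Matrix.trace_smul, hL.trace_eq_zero, smul_zero]

theorem exp_apply_eq_self {L : SuperOp n} {g : Mat n} (hg : L g = 0) (t : ℝ) :
    NormedSpace.exp ((t : ℂ) • L) g = g := by
  refine exp_map_eq_map_one (𝔸 := SuperOp n) (ContinuousLinearMap.apply ℂ (Mat n) g) fun k => ?_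
  rw [ContinuousLinearMap.apply_apply, pow_succ, mul_apply_eq_comp,
    smul_apply, hg, smul_zero, map_zero]

/-! ### Choi matrices and conditional complete positivity. -/

open scoped ComplexOrder

/-- The Choi matrix of a linear map, with entries `⟨i| Φ(|a⟩⟨b|) |j⟩` at `((i, a), (j, b))`. -/
def choi (Φ : SuperOp n) : Matrix (Fin n × Fin n) (Fin n × Fin n) ℂ :=
  Matrix.of fun p q => Φ (Matrix.single p.2 q.2 1) p.1 q.1

theorem choi_apply (Φ : SuperOp n) (p q : Fin n × Fin n) :
    choi Φ p q = Φ (Matrix.single p.2 q.2 1) p.1 q.1 := rfl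

theorem apply_eq_sum_choi (Φ : SuperOp n) (ρ : Mat n) (i j : Fin n) :
    Φ ρ i j = ∑ a, ∑ b, choi Φ (i, a) (j, b) * ρ a b := by
  conv_lhs => rw [Matrix.matrix_eq_sum_single ρ]
  simp only [map_sum, Matrix.sum_apply, choi_apply]
  refine Finset.sum_congr rfl fun a _ => Finset.sum_congr rfl fun b _ => ?_
  rw [show Matrix.single a b (ρ a b) = ρ a b • Matrix.single a b (1 : ℂ) by simp, map_smul,
    Matrix.smul_apply, smul_eq_mul, mul_comm]

theorem continuous_choi : Continuous (choi : SuperOp n → _) := by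
  refine continuous_matrix fun p q => ?_
  exact (((ContinuousLinearMap.apply ℂ (Mat n)
    (Matrix.single p.2 q.2 (1 : ℂ))).continuous).matrix_elem p.1 q.1)

theorem choi_smul_sub (c : ℂ) (Φ Ψ : SuperOp n) :
    choi (c • (Φ - Ψ)) = c • (choi Φ - choi Ψ) := rfl

/-- The unnormalised maximally entangled vector. -/
def entangledVec (n : ℕ) : Fin n × Fin n → ℂ := fun p => if p.1 = p.2 then 1 else 0

theorem choi_one : choi (1 : SuperOp n) =
    Matrix.vecMulVec (entangledVec n) (entangledVec n) := by
  ext p q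
  rw [choi_apply, one_apply_eq_self, Matrix.vecMulVec_apply, Matrix.single_apply]
  simp only [entangledVec, ← ite_and, eq_comm, mul_ite, mul_one, mul_zero]
  grind

theorem exists_eq_star_mul_self_of_nonneg {A : Type*} [NonUnitalCStarAlgebra A] [PartialOrder A]
    [StarOrderedRing A] {a : A} (ha : 0 ≤ a) : ∃ b, a = star b * b :=
  CStarAlgebra.nonneg_iff_eq_star_mul_self.mp ha

theorem choi_posSemidef {Φ : SuperOp n} (hΦ : Φ ∈ cpCone n) : (choi Φ).PosSemidef := by
  -- The block matrix of matrix units is `n⁻¹ Y* Y`, hence nonnegative; a square root of the image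
  -- of `Y* Y`, reindexed, factorises the Choi matrix.
  let Y : CStarMatrix (Fin n) (Fin n) (Mat n) :=
    CStarMatrix.ofMatrix fun c b => Matrix.single c b (1 : ℂ)
  have hY (a b : Fin n) : (star Y * Y) a b = (n : ℂ) • Matrix.single a b (1 : ℂ) := by
    rw [CStarMatrix.mul_apply]
    have h (c : Fin n) : star Y a c * Y c b = Matrix.single a b (1 : ℂ) := by
      change (Matrix.single c a (1 : ℂ))ᴴ * Matrix.single c b 1 = _
      simp
    simp [h]
  obtain ⟨Z, hZ⟩ := exists_eq_star_mul_self_of_nonneg (hΦ n _ (star_mul_self_nonneg Y))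
  have hZ' (a b : Fin n) : (n : ℂ) • Φ (Matrix.single a b 1) = ∑ c, (Z c a)ᴴ * Z c b := by
    have h := congrFun (congrFun hZ a) b
    rw [CStarMatrix.map_apply, hY, map_smul] at h
    rw [h, CStarMatrix.mul_apply]
    rfl
  let W : Matrix (Fin n × Fin n) (Fin n × Fin n) ℂ := Matrix.of fun r p => Z r.1 p.2 r.2 p.1
  have hW : choi Φ = (n : ℂ)⁻¹ • (Wᴴ * W) := by
    ext p q
    have hn : (n : ℂ) ≠ 0 := by exact_mod_cast (Fin.pos p.1).ne'
    have h := congrFun (congrFun (hZ' p.2 q.2) p.1) q.1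
    rw [Matrix.smul_apply, eq_inv_smul_iff₀ hn, choi_apply, ← Matrix.smul_apply, h,
      Matrix.sum_apply, Matrix.mul_apply, Fintype.sum_prod_type]
    rfl
  rw [hW]
  refine (Matrix.posSemidef_conjTranspose_mul_self W).smul ?_
  positivity

/-- The projection onto the orthogonal complement of the maximally entangled vector. -/
def entangledCompl (n : ℕ) : Matrix (Fin n × Fin n) (Fin n × Fin n) ℂ :=
  1 - (n : ℂ)⁻¹ • Matrix.vecMulVec (entangledVec n) (entangledVec n)

theorem star_entangledVec : star (entangledVec n) = entangledVec n := by
  ext p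
  simp [entangledVec, apply_ite]

theorem entangledVec_dotProduct : entangledVec n ⬝ᵥ entangledVec n = n := by
  simp [dotProduct, entangledVec, Fintype.sum_prod_type]

theorem conjTranspose_entangledCompl : (entangledCompl n)ᴴ = entangledCompl n := by
  simp [entangledCompl, Matrix.conjTranspose_sub, Matrix.conjTranspose_smul,
    Matrix.conjTranspose_vecMulVec, star_entangledVec]

theorem entangledCompl_mulVec : entangledCompl n *ᵥ entangledVec n = 0 := by
  rcases Nat.eq_zero_or_pos n with rfl | hn
  · exact Subsingleton.elim _ _
  have hn' : (n : ℂ) ≠ 0 := by exact_mod_cast hn.ne'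
  rw [entangledCompl, Matrix.sub_mulVec, Matrix.one_mulVec, Matrix.smul_mulVec,
    Matrix.vecMulVec_mulVec, entangledVec_dotProduct]
  ext p
  simp only [Pi.sub_apply, Pi.smul_apply, MulOpposite.smul_eq_mul_unop, MulOpposite.unop_op,
    smul_eq_mul, Pi.zero_apply]
  field_simp
  ring

theorem choi_isHermitian_of_exp {L : SuperOp n}
    (h : ∀ t : ℝ, 0 ≤ t → NormedSpace.exp ((t : ℂ) • L) ∈ cpCone n) : (choi L).IsHermitian := by
  have hc : IsClosed {M : Matrix (Fin n × Fin n) (Fin n × Fin n) ℂ | Mᴴ = M} :=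
    isClosed_eq (by fun_prop) continuous_id
  refine hc.mem_of_tendsto ((continuous_choi.tendsto L).comp (tendsto_inv_smul_exp_sub_one (𝔸 := SuperOp n) L)) ?_
  filter_upwards [self_mem_nhdsWithin] with t (ht : 0 < t)
  have h1 := (choi_posSemidef (h t ht.le)).isHermitian
  have h2 := (choi_posSemidef (one_mem_cpCone (n := n))).isHermitian
  rw [Function.comp_apply, choi_smul_sub, Matrix.conjTranspose_smul,
    Matrix.conjTranspose_sub, h1.eq, h2.eq, star_inv₀, Complex.star_def, Complex.conj_ofReal]

/-- The generator of a completely positive semigroup is conditionally completely positive. -/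
theorem compressed_choi_posSemidef {L : SuperOp n}
    (h : ∀ t : ℝ, 0 ≤ t → NormedSpace.exp ((t : ℂ) • L) ∈ cpCone n) :
    (entangledCompl n * choi L * entangledCompl n).PosSemidef := by
  rw [← Matrix.nonneg_iff_posSemidef]
  have hcont : Continuous fun Φ : SuperOp n => entangledCompl n * choi Φ * entangledCompl n :=
    (continuous_const.mul continuous_choi).mul continuous_const
  refine ge_of_tendsto ((hcont.tendsto L).comp (tendsto_inv_smul_exp_sub_one (𝔸 := SuperOp n) L)) ?_
  filter_upwards [self_mem_nhdsWithin] with t (ht : 0 < t)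
  have h1 := (choi_posSemidef (h t ht.le)).mul_mul_conjTranspose_same (entangledCompl n)
  rw [conjTranspose_entangledCompl] at h1
  -- The identity has Choi matrix `ω ωᵀ`, which the compression kills, so the difference quotient is
  -- a positive multiple of a compressed positive matrix.
  rw [Function.comp_apply, choi_smul_sub, choi_one, Matrix.mul_smul, Matrix.smul_mul,
    Matrix.mul_sub, Matrix.mul_vecMulVec, entangledCompl_mulVec, Matrix.zero_vecMulVec, sub_zero]
  rw [Matrix.nonneg_iff_posSemidef]
  refine h1.smul ?_
  have : 0 ≤ t⁻¹ := by positivity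
  exact_mod_cast this

theorem exists_choi_eq {L : SuperOp n}
    (h : ∀ t : ℝ, 0 ≤ t → NormedSpace.exp ((t : ℂ) • L) ∈ cpCone n) :
    ∃ (C : Matrix (Fin n × Fin n) (Fin n × Fin n) ℂ) (κ : Fin n × Fin n → ℂ),
      choi L = Cᴴ * C + Matrix.vecMulVec κ (entangledVec n) +
        Matrix.vecMulVec (entangledVec n) (star κ) := by
  obtain ⟨C, hC⟩ := CStarAlgebra.nonneg_iff_eq_star_mul_self.mp
    (compressed_choi_posSemidef h).nonneg
  have hH := choi_isHermitian_of_exp h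
  set W := choi L with hW
  set ω := entangledVec n with hω
  set c : ℂ := ω ⬝ᵥ W *ᵥ ω with hc
  have hWω : ω ᵥ* W = star (W *ᵥ ω) := by
    rw [Matrix.star_mulVec, star_entangledVec, hH.eq]
  have hcr : star c = c := by
    rw [hc, ← Matrix.star_dotProduct_star, ← hWω, star_entangledVec, Matrix.dotProduct_mulVec]
  -- Expanding the compression of `W` leaves the term `n⁻² c ω ω*`; since `c` is real, half of it
  -- goes into each of the two `κ` terms.
  refine ⟨C, (n : ℂ)⁻¹ • (W *ᵥ ω) - ((n : ℂ)⁻¹ ^ 2 * c / 2) • ω, ?_⟩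
  rw [← Matrix.star_eq_conjTranspose, ← hC, entangledCompl, ← hω, sub_mul, one_mul, mul_sub,
    mul_one, sub_mul, Matrix.smul_mul, Matrix.mul_smul, Matrix.mul_smul, Matrix.smul_mul,
    Matrix.mul_vecMulVec, Matrix.vecMulVec_mul, Matrix.vecMulVec_mul_vecMulVec,
    ← Matrix.dotProduct_mulVec, ← hc, hWω, star_sub, star_smul, star_smul, hω, star_entangledVec]
  ext p q
  simp [Matrix.vecMulVec_apply, hcr]
  ring

theorem isGKSL_of_exp {L : SuperOp n}
    (h : ∀ t : ℝ, 0 ≤ t → NormedSpace.exp ((t : ℂ) • L) ∈ cpCone n)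
    (htr : ∀ ρ, (L ρ).trace = 0) : IsGKSL L := by
  obtain ⟨C, κ, hC⟩ := exists_choi_eq h
  let K : Mat n := Matrix.of fun i a => κ (i, a)
  -- The rows of `C` are conjugated because `Cᴴ * C` conjugates its left factor.
  let V : Fin n × Fin n → Mat n := fun k => Matrix.of fun i a => star (C k (i, a))
  have hL (ρ : Mat n) : L ρ = K * ρ + ρ * Kᴴ + ∑ k, V k * ρ * (V k)ᴴ := by
    ext i j
    rw [apply_eq_sum_choi, hC]
    simp only [Matrix.add_apply, Matrix.sum_apply, add_mul, Finset.sum_add_distrib]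
    rw [add_assoc, add_comm]
    congr 1
    · congr 1
      · simp [Matrix.vecMulVec_apply, entangledVec, Matrix.mul_apply, K]
      · rw [Finset.sum_comm]
        simp [Matrix.vecMulVec_apply, entangledVec, Matrix.mul_apply, K, mul_comm]
    · simp only [Matrix.mul_apply, Finset.sum_mul, V, Matrix.of_apply, Matrix.conjTranspose_apply,
        star_star]
      rw [Finset.sum_comm]
      simp_rw [Finset.sum_comm (s := Finset.univ (α := Fin n))
        (t := Finset.univ (α := Fin n × Fin n))]
      refine Finset.sum_congr rfl fun k _ => Finset.sum_congr rfl fun b _ =>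
        Finset.sum_congr rfl fun a _ => by ring
  -- `tr (L ρ) = tr ((K + K† + ∑ Vₖ† Vₖ) ρ)` vanishes for every `ρ`, and the trace pairing is
  -- nondegenerate.
  refine isGKSL_of_form (K := K) (V := V) (Matrix.ext_iff_trace_mul_right.mpr fun ρ => ?_) hL
  rw [zero_mul, Matrix.trace_zero, ← htr ρ, hL, add_mul, add_mul, Matrix.trace_add,
    Matrix.trace_add, Matrix.trace_add, Matrix.trace_add, Matrix.trace_mul_comm ρ, trace_sum_conj]

/-- The Gorini–Kossakowski–Sudarshan–Lindblad theorem. -/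
theorem mem_lieWedge_CPTP_iff {L : SuperOp n} : L ∈ lieWedge (CPTP n) ↔ IsGKSL L := by
  refine ⟨fun h => ?_, fun hL t ht => exp_mem_CPTP hL ht⟩
  refine isGKSL_of_exp (fun t ht => (mem_CPTP_iff.mp (h t ht)).1) fun ρ => ?_
  exact map_eq_zero_of_exp_map_eq (𝔸 := SuperOp n) (traceAt ρ)
    fun t ht => (mem_CPTP_iff.mp (h t ht)).2 ρ

theorem exp_apply_eq_self_iff {L : SuperOp n} {g : Mat n} :
    (∀ t : ℝ, 0 ≤ t → NormedSpace.exp ((t : ℂ) • L) g = g) ↔ L g = 0 :=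
  ⟨fun h => map_eq_zero_of_exp_map_eq (𝔸 := SuperOp n) (ContinuousLinearMap.apply ℂ (Mat n) g) h,
    fun h t _ => exp_apply_eq_self h t⟩

end QuantumMaps

end

theorem mainTheorem7 (n : ℕ) (H₀ : QuantumMaps.Mat n) (hH₀ : H₀.IsHermitian)
    (T : ℝ≥0∞) (hT : 0 < T) :
    QuantumMaps.lieWedge (QuantumMaps.Gibbs H₀ T) =
        {L | QuantumMaps.IsGKSL L ∧ L (QuantumMaps.gibbsMatrix H₀ T) = 0} ∧
      QuantumMaps.lieWedge (QuantumMaps.EnTO H₀ T) =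
        {L | L ∈ QuantumMaps.lieWedge (QuantumMaps.Gibbs H₀ T) ∧
          ⁅L, QuantumMaps.adOp H₀⁆ = 0} := by
  constructor
  · ext L
    rw [Set.mem_ofPred_eq, ← QuantumMaps.mem_lieWedge_CPTP_iff,
      ← QuantumMaps.exp_apply_eq_self_iff]
    exact ⟨fun h => ⟨fun t ht => (h t ht).1, fun t ht => (h t ht).2⟩,
      fun h t ht => ⟨h.1 t ht, h.2 t ht⟩⟩
  · ext L
    rw [Set.mem_ofPred_eq, ← exp_lie_eq_zero_iff (𝔸 := QuantumMaps.SuperOp n)]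
    exact ⟨fun h => ⟨fun t ht => (h t ht).1, fun t ht => (h t ht).2⟩,
      fun h t ht => ⟨h.1 t ht, h.2 t ht⟩⟩
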